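/- The Link Smoothing Game is played on a connected link shadow $D$ (a connected link diagram without over/under information) on the sphere with finitely many, and at least one, crossings. Two players, C and D, alternately choose a crossing that has not been smoothed yet and smooth it in either of the two possible ways. When all crossings have been smoothed, the diagram is a disjoint union of closed curves; player C wins if it is connected (a single curve), and player D wins otherwise. The shadow is a $\mathcal P$-position if the player who moves second has a winning strategy, whichever of the two players that is. Given a checkerboard colouring of the regions of $D$ (the two sides of every arc have different colours), the associated planar multigraph $G$ has the shaded regions as vertices, and every crossing is an edge of $G$, joining the two shaded regions that meet at opposite corners of the crossing (a loop if they coincide). Theorem. Let $G$ be a (connected, planar) graph associated to a connected link shadow $D$ on the sphere with at least one crossing. If the Link Smoothing Game on $D$ is a $\mathcal P$-position, then $G$ is composed of two edge-disjoint spanning trees: there are spanning trees $T_1, T_2$ of $G$ with $E(T_1)\cap E(T_2)=\emptyset$ and $E(T_1)\cup E(T_2)=E(G)$. -/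

import Mathlib

open scoped Graph

namespace LinkSmoothing

/-! ### Trees in multigraphs -/

section Multigraph

variable {α β : Type*}

/-- A multigraph is connected if it has a vertex and any two of its vertices are joined by a
walk. -/
def IsConnected (G : Graph α β) : Prop :=
  V(G).Nonempty ∧ ∀ x ∈ V(G), ∀ y ∈ V(G), Relation.ReflTransGen G.Adj x y

/-- A multigraph has a cycle if, for some `k`, there are `k + 1` distinct vertices
`v 0, …, v k` and `k + 1` distinct edges `e 0, …, e k`, the edge `e i` joining `v i` to `v (i + 1)`
(indices modulo `k + 1`). A loop is a cycle with `k = 0`, two parallel edges form a cycle with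
`k = 1`. -/
def HasCycle (G : Graph α β) : Prop :=
  ∃ (k : ℕ) (v : Fin (k + 1) → α) (e : Fin (k + 1) → β),
    Function.Injective v ∧ Function.Injective e ∧ ∀ i, G.IsLink (e i) (v i) (v (i + 1))

/-- `T` is a spanning tree of `G`: a subgraph with all vertices of `G` that is connected and has no
cycle. -/
def IsSpanningTree (T G : Graph α β) : Prop :=
  T.IsSpanningSubgraph G ∧ IsConnected T ∧ ¬ HasCycle T

end Multigraph

/-! ### Link shadows -/

/-- The half-edges of a link shadow with set of precrossings `C`: the pair `(c, i)` is the `i`-th of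
the four half-edges that leave the precrossing `c`, numbered counterclockwise around `c`. -/
abbrev HalfEdge (C : Type*) := C × ZMod 4

/-- A link shadow with set of precrossings `C`, drawn on an oriented surface which it cuts into
discs, up to homeomorphism: the half-edges that leave the precrossings are paired off by the arcs of
the diagram that run between precrossings. Such a pairing is a `4`-valent combinatorial map, whose
rotation at each precrossing is the numbering of its half-edges. -/
structure Shadow (C : Type*) where
  /-- The half-edge at the other end of the arc that starts with the given half-edge. -/
  arc : HalfEdge C → HalfEdge C
  arc_involutive : Function.Involutive arc
  arc_ne : ∀ h, arc h ≠ h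

namespace Shadow

variable {C : Type*} (D : Shadow C)

/-- The half-edge `(c, i)` also stands for the corner at `c` between the half-edges `(c, i)` and
`(c, i + 1)`, which lies to the left of somebody who leaves `c` along `(c, i)`. If that person
arrives at `d` along the half-edge `(d, j)`, the corner to the left is then `(d, j - 1)`. The
permutation `boundary` maps `(c, i)` to `(d, j - 1)`, so it follows the boundary of a region from
corner to corner. -/
def boundary : Equiv.Perm (HalfEdge C) :=
  (D.arc_involutive.toPerm).trans ((Equiv.refl C).prodCongr (Equiv.subRight (1 : ZMod 4)))

/-- The regions of the shadow: the orbits of corners under `boundary`. -/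
def Region : Type _ := Quotient (Equiv.Perm.SameCycle.setoid D.boundary)

/-- The region that contains the corner at `c` between the half-edges `(c, i)` and `(c, i + 1)`. -/
def region (h : HalfEdge C) : D.Region := Quotient.mk _ h

/-- Euler's formula `V - E + F = 2` for a connected shadow on the sphere: the shadow has `|C|`
vertices (the precrossings) and `2 |C|` edges (the arcs), so this says that it has `|C| + 2`
regions. -/
def IsSpherical : Prop := Nat.card D.Region = Nat.card C + 2

/-! ### Smoothings and the Link Smoothing Game -/

/-- A position of the Link Smoothing Game records for each precrossing whether it is still there
(`none`) or has been smoothed, and in which of the two ways (`some true`, `some false`). -/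
abbrev Position (C : Type*) := C → Option Bool

/-- The two smoothings of a precrossing: `true` joins its half-edge `0` to `1` and `2` to `3`,
`false` joins `0` to `3` and `1` to `2`. -/
def partner : Bool → ZMod 4 → ZMod 4
  | true, i => 1 - i
  | false, i => 3 - i

/-- Two half-edges touch in the diagram of a position if they belong to the same arc, or they leave
the same unsmoothed precrossing, or they have been joined when their precrossing was smoothed. -/
inductive Touch (s : Position C) : HalfEdge C → HalfEdge C → Prop
  | arc (h : HalfEdge C) : Touch s h (D.arc h)
  | precrossing (c : C) (i j : ZMod 4) (hc : s c = none) : Touch s (c, i) (c, j)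
  | smoothed (c : C) (b : Bool) (i : ZMod 4) (hc : s c = some b) :
      Touch s (c, i) (c, partner b i)

/-- The partially smoothed diagram of a position is connected. If no precrossing is left, the
diagram is a disjoint union of closed curves, and this says that there is only one of them. -/
def ConnectedAt (s : Position C) : Prop :=
  Nonempty (HalfEdge C) ∧ ∀ h h' : HalfEdge C, Relation.EqvGen (D.Touch s) h h'

/-- The starting position: no precrossing has been smoothed. -/
def start : Position C := fun _ => none

/-- The shadow is connected. -/
def IsConnected : Prop := D.ConnectedAt start

/-- The two players of the Link Smoothing Game. -/
inductive Player
  /-- wants to end the game with a connected diagram -/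
  | connecter
  /-- wants to end the game with a disconnected diagram -/
  | disconnecter

/-- The opponent of a player. -/
def Player.opponent : Player → Player
  | .connecter => .disconnecter
  | .disconnecter => .connecter

/-- The player who has won when the game ends at the position `s`. -/
def WonBy (s : Position C) : Player → Prop
  | .connecter => D.ConnectedAt s
  | .disconnecter => ¬ D.ConnectedAt s

/-- `D.HasWinningStrategy P Q s`: the player `P` has a winning strategy in the Link Smoothing Game
that starts at the position `s` with the player `Q` to move. A move smooths one precrossing, in
either way; the players alternate until no precrossing is left. -/
inductive HasWinningStrategy [DecidableEq C] (P : Player) : Player → Position C → Prop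
  | ended (Q : Player) (s : Position C) (hs : ∀ c, s c ≠ none) (hw : D.WonBy s P) :
      HasWinningStrategy P Q s
  | move (s : Position C) (c : C) (b : Bool) (hc : s c = none)
      (hw : HasWinningStrategy P P.opponent (Function.update s c (some b))) :
      HasWinningStrategy P P s
  | reply (s : Position C) (hs : ∃ c, s c = none)
      (hw : ∀ (c : C) (b : Bool), s c = none →
        HasWinningStrategy P P (Function.update s c (some b))) :
      HasWinningStrategy P P.opponent s

/-- The game on `D` is a `P`-position: whichever of the players moves second has a winning
strategy. -/
def IsPPosition [DecidableEq C] : Prop :=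
  ∀ P : Player, D.HasWinningStrategy P P.opponent start

/-! ### Checkerboard graphs -/

/-- A checkerboard colouring of the regions: every arc has a shaded region on exactly one side. The
region to the left of the half-edge `(c, i)` has the corner `(c, i)`, the one to the right has the
corner `(c, i - 1)`. -/
structure Checkerboard where
  /-- The set of shaded regions. -/
  shaded : Set D.Region
  alternate : ∀ (c : C) (i : ZMod 4),
    D.region (c, i) ∈ shaded ↔ D.region (c, i - 1) ∉ shaded

/-- The graph associated to a shadow with a checkerboard colouring. Its vertices are the shaded
regions; every precrossing is an edge, which joins the shaded regions at two opposite corners of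
that precrossing (a loop, if they are the same region). -/
def Checkerboard.graph {D : Shadow C} (K : D.Checkerboard) : Graph D.Region C where
  vertexSet := K.shaded
  IsLink c x y := ∃ i : ZMod 4, x = D.region (c, i) ∧ y = D.region (c, i + 2) ∧
    x ∈ K.shaded ∧ y ∈ K.shaded
  isLink_symm := by
    rintro c -
    refine ⟨?_⟩
    rintro x y ⟨i, rfl, rfl, hx, hy⟩
    refine ⟨i + 2, rfl, ?_, hy, hx⟩
    rw [add_assoc, show (2 + 2 : ZMod 4) = 0 from rfl, add_zero]
  eq_or_eq_of_isLink_of_isLink := by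
    rintro c x y v w ⟨i, rfl, rfl, hx, -⟩ ⟨j, rfl, rfl, hv, hw⟩
    have key : ∀ i j : ZMod 4, i = j ∨ i = j + 2 ∨ j = i - 1 ∨ j + 2 = i - 1 := by decide
    rcases key i j with h | h | h | h
    · exact Or.inl (by rw [h])
    · exact Or.inr (by rw [h])
    · exact absurd (h ▸ hv) ((K.alternate c i).1 hx)
    · exact absurd (h ▸ hw) ((K.alternate c i).1 hx)
  left_mem_of_isLink := by
    rintro c x y ⟨i, -, -, hx, -⟩
    exact hx

end Shadow

end LinkSmoothing

/-! Call an edge of `G` chosen if its precrossing is smoothed so as to merge the two shaded corners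
there. If the final diagram is a single curve, the chosen edges connect `G`, because the curve runs
past every shaded region (`isConnected_restrict`). The unshaded regions are likewise connected by
the other smoothings, and Euler's formula then leaves exactly |V| - 1 chosen edges
(`ncard_smoothedAs_merging_add_one`).

In a P-position the connecter wins as second player. Against a disconnecter who always merges, at
least half of the edges become chosen (`exists_final_ncard`), so |E| ≤ 2|V| - 2. Now let two people
claim edges alternately, each following the connecter's strategy and reading a rival's claim as a
non-merging move of the disconnecter. The one who begins imagines such a move beforehand; surplus
edges do no harm. Both end with a connected spanning set (`Follows.exists_partition`), and the bound
on |E| makes both sets trees (`exists_isSpanningTree_of_partition`). -/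

namespace LinkSmoothing

/-! ### Counting edges of connected multigraphs -/

section Multigraph

variable {α β : Type*} {G : Graph α β}

theorem reflTransGen_adj_symm {x y : α} (h : Relation.ReflTransGen G.Adj x y) :
    Relation.ReflTransGen G.Adj y x := by
  induction h with
  | refl => exact .refl
  | tail _ hbc ih => exact .head ((G.adj_comm _ _).1 hbc) ih

theorem IsConnected.of_adj {H : Graph α β} (hG : IsConnected G) (hV : V(H) = V(G))
    (h : ∀ x y, G.Adj x y → Relation.ReflTransGen H.Adj x y) : IsConnected H := by
  refine ⟨hV ▸ hG.1, fun x hx y hy => ?_⟩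
  have := hG.2 x (hV ▸ hx) y (hV ▸ hy)
  clear hy
  induction this with
  | refl => exact .refl
  | tail _ hbc ih => exact ih.trans (h _ _ hbc)

theorem IsConnected.restrict_mono {F F' : Set β} (h : IsConnected (G.restrict F)) (hF : F ⊆ F') :
    IsConnected (G.restrict F') :=
  h.of_adj rfl fun _ _ hxy => .single (hxy.mono (G.restrict_mono_right hF))

/-- A connected multigraph has at most one vertex more than it has edges. -/
theorem IsConnected.ncard_vertexSet_le [Finite β] (h : IsConnected G) (hV : V(G).Finite) :
    V(G).ncard ≤ E(G).ncard + 1 := by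
  have : Finite V(G) := hV
  -- Forgetting loops and multiplicities keeps connectedness and does not increase the number of
  -- edges.
  let S : SimpleGraph V(G) := SimpleGraph.fromRel fun x y => G.Adj x y
  have hS : S.Connected := by
    have : Nonempty V(G) := h.1.to_subtype
    refine ⟨fun x y => ?_⟩
    have key : ∀ z, Relation.ReflTransGen G.Adj x z → ∃ hz : z ∈ V(G), S.Reachable x ⟨z, hz⟩ := by
      intro z hz
      induction hz with
      | refl => exact ⟨x.2, .refl _⟩
      | @tail b c _ hbc ih =>
        obtain ⟨hb, ih⟩ := ih
        refine ⟨hbc.right_mem, ?_⟩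
        by_cases hne : b = c
        · subst hne; exact ih
        · exact ih.trans (SimpleGraph.Adj.reachable
            ((SimpleGraph.fromRel_adj _ _ _).2 ⟨fun h => hne (congrArg Subtype.val h), .inl hbc⟩))
    exact (key y (h.2 x x.2 y y.2)).2
  have hedge : ∀ e : S.edgeSet, ∃ f : E(G), ∃ x y : V(G), s(x, y) = e.1 ∧ G.IsLink f x y := by
    rintro ⟨e, he⟩
    induction e with
    | _ x y =>
      obtain ⟨-, ⟨f, hf⟩ | ⟨f, hf⟩⟩ :=
        (SimpleGraph.fromRel_adj _ _ _).1 (show S.Adj x y from he)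
      · exact ⟨⟨f, hf.edge_mem⟩, x, y, rfl, hf⟩
      · exact ⟨⟨f, hf.edge_mem⟩, x, y, rfl, hf.symm⟩
  choose φ hφ using hedge
  have hinj : Function.Injective φ := by
    intro e e' hee
    obtain ⟨x, y, hxy, hl⟩ := hφ e
    obtain ⟨x', y', hxy', hl'⟩ := hφ e'
    rw [hee] at hl
    refine Subtype.ext (hxy.symm.trans (Eq.trans ?_ hxy'))
    rcases hl.eq_and_eq_or_eq_and_eq hl' with ⟨h1, h2⟩ | ⟨h1, h2⟩
    · rw [Subtype.ext h1, Subtype.ext h2]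
    · rw [Subtype.ext h1, Subtype.ext h2, Sym2.eq_swap]
  have h1 := hS.card_vert_le_card_edgeSet_add_one
  have h2 := Nat.card_le_card_of_injective φ hinj
  rw [Nat.card_coe_set_eq] at h1 h2
  rw [Nat.card_coe_set_eq] at h2
  rw [Nat.card_coe_set_eq] at h1
  omega

/-- The last edge of a cycle of a connected multigraph can be deleted. -/
theorem IsConnected.exists_restrict_of_hasCycle (h : IsConnected G) (hc : HasCycle G) :
    ∃ e ∈ E(G), IsConnected (G.restrict {e}ᶜ) := by
  obtain ⟨k, v, e, -, he, hl⟩ := hc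
  refine ⟨e (Fin.last k), (hl _).edge_mem, h.of_adj rfl fun x y ⟨f, hf⟩ => ?_⟩
  have path : ∀ i, Relation.ReflTransGen (G.restrict {e (Fin.last k)}ᶜ).Adj (v 0) (v i) := by
    intro i
    induction i using Fin.induction with
    | zero => exact .refl
    | succ i ih =>
      refine ih.tail ⟨e i.castSucc, ?_, ?_⟩
      · simpa using fun h => (Fin.castSucc_lt_last i).ne (he h)
      · simpa [Fin.coeSucc_eq_succ] using hl i.castSucc
  by_cases hfe : f = e (Fin.last k)
  · subst hfe
    have hl' := hl (Fin.last k)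
    rw [Fin.last_add_one] at hl'
    rcases hf.eq_and_eq_or_eq_and_eq hl' with ⟨rfl, rfl⟩ | ⟨rfl, rfl⟩
    · exact reflTransGen_adj_symm (path _)
    · exact path _
  · exact .single ⟨f, hfe, hf⟩

/-- Deleting an edge of a cycle would leave a connected multigraph with fewer than |V| - 1 edges. -/
theorem IsConnected.not_hasCycle [Finite β] (h : IsConnected G) (hV : V(G).Finite)
    (hcard : E(G).ncard < V(G).ncard) : ¬ HasCycle G := by
  intro hc
  obtain ⟨e, he, h'⟩ := h.exists_restrict_of_hasCycle hc
  have h1 := h'.ncard_vertexSet_le hV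
  have h2 : E(G.restrict {e}ᶜ) ⊂ E(G) := by
    refine ⟨fun f hf => hf.1, fun hs => (hs he).2 rfl⟩
  have h3 := Set.ncard_lt_ncard h2
  change V(G).ncard ≤ _ at h1
  omega

/-- If the at most `2 |V| - 2` edges of a multigraph are parted into two sets that give
connected spanning subgraphs, then both of these are spanning trees. -/
theorem exists_isSpanningTree_of_partition [Finite β] (hV : V(G).Finite)
    (hcard : E(G).ncard + 2 ≤ 2 * V(G).ncard) {F F' : Set β} (hdisj : Disjoint F F')
    (hunion : F ∪ F' = E(G)) (hF : IsConnected (G.restrict F)) (hF' : IsConnected (G.restrict F')) :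
    ∃ T₁ T₂ : Graph α β, IsSpanningTree T₁ G ∧ IsSpanningTree T₂ G ∧
      Disjoint T₁.edgeSet T₂.edgeSet ∧ T₁.edgeSet ∪ T₂.edgeSet = G.edgeSet := by
  have e1 : E(G.restrict F) = F :=
    Set.inter_eq_right.2 (hunion ▸ Set.subset_union_left)
  have e2 : E(G.restrict F') = F' :=
    Set.inter_eq_right.2 (hunion ▸ Set.subset_union_right)
  -- Each part has at least |V| - 1 edges and together they have at most 2|V| - 2, so both bounds
  -- are attained.
  have h1 := hF.ncard_vertexSet_le hV
  have h2 := hF'.ncard_vertexSet_le hV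
  have h3 := Set.ncard_union_eq hdisj
  rw [hunion] at h3
  have v1 : V(G.restrict F) = V(G) := rfl
  have v2 : V(G.restrict F') = V(G) := rfl
  rw [v1, e1] at h1
  rw [v2, e2] at h2
  refine ⟨G.restrict F, G.restrict F', ⟨⟨Graph.restrict_le, rfl⟩, hF, ?_⟩,
    ⟨⟨Graph.restrict_le, rfl⟩, hF', ?_⟩, e1.symm ▸ e2.symm ▸ hdisj, e1.symm ▸ e2.symm ▸ hunion⟩
  · exact hF.not_hasCycle hV (by rw [e1, v1]; omega)
  · exact hF'.not_hasCycle hV (by rw [e2, v2]; omega)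

end Multigraph

end LinkSmoothing

namespace LinkSmoothing.Shadow

/-! ### Playing the connecter's winning strategy -/

section Strategy

variable {C : Type*}

/-- The precrossings that are smoothed in a position in the way that `m` says. -/
def smoothedAs (m : C → Bool) (s : Position C) : Set C := {c | s c = some (m c)}

/-- The precrossings that are still there in a position. -/
def remaining (s : Position C) : Set C := {c | s c = none}

variable [DecidableEq C] {D : Shadow C} {m : C → Bool}

theorem remaining_update (s : Position C) (c : C) (b : Bool) :
    remaining (Function.update s c (some b)) = remaining s \ {c} := by
  ext d
  by_cases h : d = c
  · subst h; simp [remaining]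
  · simp [remaining, h]

theorem smoothedAs_update_self (s : Position C) (c : C) :
    smoothedAs m (Function.update s c (some (m c))) = insert c (smoothedAs m s) := by
  ext d
  by_cases h : d = c
  · subst h; simp [smoothedAs]
  · simp [smoothedAs, h]

theorem smoothedAs_update_of_ne (s : Position C) {c : C} {b : Bool} (hb : b ≠ m c) :
    smoothedAs m (Function.update s c (some b)) = smoothedAs m s \ {c} := by
  ext d
  by_cases h : d = c
  · subst h; simp [smoothedAs, hb]
  · simp [smoothedAs, h]

theorem smoothedAs_update_subset (s : Position C) (c : C) (b : Bool) :
    smoothedAs m (Function.update s c (some b)) ⊆ insert c (smoothedAs m s) := by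
  by_cases hb : b = m c
  · rw [hb, smoothedAs_update_self]
  · rw [smoothedAs_update_of_ne s hb]
    exact Set.sdiff_subset.trans (Set.subset_insert _ _)

theorem HasWinningStrategy.connecter_to_move {s : Position C}
    (h : D.HasWinningStrategy .connecter .connecter s) :
    ((∀ c, s c ≠ none) ∧ D.ConnectedAt s) ∨ ∃ c b, s c = none ∧
      D.HasWinningStrategy .connecter .disconnecter (Function.update s c (some b)) := by
  cases h with
  | ended _ _ hs hw => exact .inl ⟨hs, hw⟩
  | move _ c b hc hw => exact .inr ⟨c, b, hc, hw⟩

theorem HasWinningStrategy.disconnecter_to_move {s : Position C}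
    (h : D.HasWinningStrategy .connecter .disconnecter s) :
    ((∀ c, s c ≠ none) ∧ D.ConnectedAt s) ∨ (∃ c, s c = none) ∧ ∀ c b, s c = none →
      D.HasWinningStrategy .connecter .connecter (Function.update s c (some b)) := by
  cases h with
  | ended _ _ hs hw => exact .inl ⟨hs, hw⟩
  | reply _ hs hw => exact .inr ⟨hs, hw⟩

theorem HasWinningStrategy.exists_final (m : C → Bool) {Q : Player} {s : Position C}
    (h : D.HasWinningStrategy .connecter Q s) : ∃ t : Position C, (∀ c, t c ≠ none) ∧
      D.ConnectedAt t ∧ smoothedAs m t ⊆ smoothedAs m s ∪ remaining s := by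
  have step : ∀ {s : Position C} {c : C} {b : Bool}, s c = none →
      smoothedAs m (Function.update s c (some b)) ∪ remaining (Function.update s c (some b)) ⊆
        smoothedAs m s ∪ remaining s := by
    intro s c b hc
    rw [remaining_update]
    refine Set.union_subset ((smoothedAs_update_subset s c b).trans
      (Set.insert_subset (.inr hc) Set.subset_union_left))
      (Set.sdiff_subset.trans Set.subset_union_right)
  induction h with
  | ended Q s hs hw => exact ⟨s, hs, hw, Set.subset_union_left⟩
  | move s c b hc _ ih =>
    obtain ⟨t, h1, h2, h3⟩ := ih
    exact ⟨t, h1, h2, h3.trans (step hc)⟩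
  | reply s hs _ ih =>
    obtain ⟨c, hc⟩ := hs
    obtain ⟨t, h1, h2, h3⟩ := ih c true hc
    exact ⟨t, h1, h2, h3.trans (step hc)⟩

/-- If the disconnecter always chooses the smoothings in `m`, then at least half of the remaining
precrossings (rounded down if the connecter is to move) will be smoothed so. -/
theorem HasWinningStrategy.exists_final_ncard [Finite C] (m : C → Bool) {Q : Player}
    {s : Position C} (h : D.HasWinningStrategy .connecter Q s) :
    ∃ t : Position C, (∀ c, t c ≠ none) ∧ D.ConnectedAt t ∧
      (Q = .disconnecter →
        2 * (smoothedAs m s).ncard + (remaining s).ncard ≤ 2 * (smoothedAs m t).ncard) ∧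
      2 * (smoothedAs m s).ncard + (remaining s).ncard ≤ 2 * (smoothedAs m t).ncard + 1 := by
  have hrem : ∀ {s : Position C} {c : C} (b : Bool), s c = none →
      (remaining (Function.update s c (some b))).ncard + 1 = (remaining s).ncard := by
    intro s c b hc
    rw [remaining_update]
    exact Set.ncard_sdiff_singleton_add_one (show c ∈ remaining s from hc)
  have hnot : ∀ {s : Position C} {c : C}, s c = none → c ∉ smoothedAs m s := by
    intro s c hc h
    rw [smoothedAs, Set.mem_ofPred_eq, hc] at h
    cases h
  induction h with
  | ended Q s hs hw =>
    have : remaining s = ∅ := Set.eq_empty_of_forall_notMem hs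
    refine ⟨s, hs, hw, ?_⟩
    rw [this, Set.ncard_empty]
    omega
  | move s c b hc _ ih =>
    obtain ⟨t, h1, h2, h3, -⟩ := ih
    have h3 := h3 rfl
    have h4 := hrem b hc
    have h5 : (smoothedAs m s).ncard ≤
        (smoothedAs m (Function.update s c (some b))).ncard := by
      by_cases hb : b = m c
      · rw [hb, smoothedAs_update_self]
        exact Set.ncard_le_ncard (Set.subset_insert _ _)
      · rw [smoothedAs_update_of_ne s hb, Set.sdiff_singleton_eq_self (hnot hc)]
    exact ⟨t, h1, h2, nofun, by omega⟩
  | reply s hs _ ih =>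
    obtain ⟨c, hc⟩ := hs
    -- A turn of the disconnecter spends one precrossing and gains one for `m`; a turn of the
    -- connecter may gain none.
    obtain ⟨t, h1, h2, -, h3⟩ := ih c (m c) hc
    have h4 := hrem (m c) hc
    rw [smoothedAs_update_self, Set.ncard_insert_of_notMem (hnot hc)] at h3
    exact ⟨t, h1, h2, fun _ => by omega, by omega⟩

/-- In the game in which the precrossings of `U` are to be claimed alternately, somebody who has
claimed those of `Y` can follow a winning strategy of the connecter, with `Q` to move; every
smoothing in `m` and every precrossing that remains in the position of the connecter's game is
claimed already or still to be claimed. -/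
def Follows (D : Shadow C) (m : C → Bool) (Q : Player) (Y U : Set C) : Prop :=
  ∃ s : Position C, D.HasWinningStrategy .connecter Q s ∧ smoothedAs m s ⊆ Y ∧
    remaining s ⊆ Y ∪ U

/-- The rival's claim is imitated by a disconnecter's move against `m`, which adds nothing to
`smoothedAs m`. -/
theorem Follows.of_opponent {Y U : Set C} (h : D.Follows m .disconnecter Y U) (u : C) :
    D.Follows m .connecter Y (U \ {u}) := by
  obtain ⟨s, hs, h1, h2⟩ := h
  have move : ∀ c, s c = none → (∀ d, s d = none → d ≠ c → d ≠ u ∨ d ∈ Y) →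
      D.HasWinningStrategy .connecter .connecter (Function.update s c (some (!m c))) →
      D.Follows m .connecter Y (U \ {u}) := by
    intro c _ hd hw
    refine ⟨_, hw, ?_, ?_⟩
    · rw [smoothedAs_update_of_ne s (by simp)]
      exact Set.sdiff_subset.trans h1
    · rw [remaining_update]
      rintro d ⟨hds, hdc⟩
      rcases hd d hds hdc with hdu | hdY
      · exact (h2 hds).imp_right fun h => ⟨h, hdu⟩
      · exact .inl hdY
  rcases hs.disconnecter_to_move with ⟨hfull, hw⟩ | ⟨⟨c, hc⟩, hw⟩
  · exact ⟨s, .ended _ _ hfull hw, h1, fun d hd => absurd hd (hfull d)⟩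
  -- If `u` is already smoothed in the imagined game, any open precrossing absorbs the
  -- disconnecter's turn.
  · by_cases hu : s u = none
    · exact move u hu (fun _ _ h => .inl h) (hw _ _ hu)
    · exact move c hc (fun d hd _ => .inl fun h => hu (h ▸ hd)) (hw _ _ hc)

/-- The precrossing chosen by the strategy is claimed. If it is claimed already, or the imagined
game is over, an arbitrary claim preserves the invariant. -/
theorem Follows.exists_claim {Y U : Set C} (h : D.Follows m .connecter Y U) (hU : U.Nonempty) :
    ∃ u ∈ U, D.Follows m .disconnecter (insert u Y) (U \ {u}) := by
  have mono : ∀ u, Y ∪ U ⊆ insert u Y ∪ U \ {u} := by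
    rintro u d (hd | hd)
    · exact .inl (.inr hd)
    · by_cases hdu : d = u
      · exact .inl (.inl hdu)
      · exact .inr ⟨hd, hdu⟩
  obtain ⟨s, hs, h1, h2⟩ := h
  obtain ⟨u, hu⟩ := hU
  rcases hs.connecter_to_move with ⟨hfull, hw⟩ | ⟨c, b, hc, hw⟩
  · exact ⟨u, hu, s, .ended _ _ hfull hw, h1.trans (Set.subset_insert _ _),
      fun d hd => absurd hd (hfull d)⟩
  · have h3 := smoothedAs_update_subset (m := m) s c b
    have h4 : remaining (Function.update s c (some b)) ⊆ Y ∪ U := by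
      rw [remaining_update]
      exact Set.sdiff_subset.trans h2
    rcases h2 hc with hcY | hcU
    · exact ⟨u, hu, _, hw, (h3.trans (Set.insert_subset hcY h1)).trans (Set.subset_insert _ _),
        h4.trans (mono u)⟩
    · exact ⟨c, hcU, _, hw, h3.trans (Set.insert_subset_insert h1), h4.trans (mono c)⟩

/-- Precrossings still open in the imagined game all lie in `Y`, so it can be played to its end
without leaving `Y`. -/
theorem Follows.exists_final {Q : Player} {Y : Set C} (h : D.Follows m Q Y ∅) :
    ∃ t : Position C, (∀ c, t c ≠ none) ∧ D.ConnectedAt t ∧ smoothedAs m t ⊆ Y := by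
  obtain ⟨s, hs, h1, h2⟩ := h
  obtain ⟨t, h3, h4, h5⟩ := hs.exists_final m
  exact ⟨t, h3, h4, h5.trans (Set.union_subset h1 (h2.trans (Set.union_empty _).subset))⟩

/-- Two players who both follow a winning strategy of the connecter part the remaining
precrossings so that both succeed. -/
theorem Follows.exists_partition [Finite C] {X Y U : Set C} (hX : D.Follows m .connecter X U)
    (hY : D.Follows m .disconnecter Y U) :
    ∃ P Q : Set C, Disjoint P Q ∧ P ∪ Q = U ∧ ∃ s t : Position C,
      ((∀ c, s c ≠ none) ∧ D.ConnectedAt s ∧ smoothedAs m s ⊆ X ∪ P) ∧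
      (∀ c, t c ≠ none) ∧ D.ConnectedAt t ∧ smoothedAs m t ⊆ Y ∪ Q := by
  obtain ⟨n, hn⟩ : ∃ n, U.ncard = n := ⟨_, rfl⟩
  induction n generalizing X Y U with
  | zero =>
    obtain rfl := (Set.ncard_eq_zero).1 hn
    obtain ⟨s, hs⟩ := hX.exists_final
    obtain ⟨t, ht⟩ := hY.exists_final
    refine ⟨∅, ∅, Set.disjoint_empty _, Set.union_empty _, s, t, ?_⟩
    rw [Set.union_empty, Set.union_empty]
    exact ⟨hs, ht⟩
  | succ n ih =>
    have hne : U.Nonempty := Set.nonempty_of_ncard_ne_zero (by omega)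
    obtain ⟨u, hu, hX'⟩ := hX.exists_claim hne
    have hcard := Set.ncard_sdiff_singleton_add_one hu
    -- After the claim the other follower is to move, so the two roles, and with them the two parts,
    -- are exchanged.
    obtain ⟨P, Q, hd, hPQ, s, t, hs, ht⟩ := ih (hY.of_opponent u) hX' (by omega)
    have huP : u ∉ P := fun h => (hPQ ▸ Set.mem_union_left Q h : u ∈ U \ {u}).2 rfl
    refine ⟨insert u Q, P, Set.disjoint_insert_left.2 ⟨huP, hd.symm⟩, ?_, t, s, ?_, hs⟩
    · rw [Set.insert_union, Set.union_comm, hPQ, Set.insert_sdiff_singleton, Set.insert_eq_of_mem hu]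
    · rwa [Set.union_insert, ← Set.insert_union]

theorem HasWinningStrategy.exists_partition [Finite C] [Nonempty C] (m : C → Bool)
    (h : D.HasWinningStrategy .connecter .disconnecter start) :
    ∃ P Q : Set C, Disjoint P Q ∧ P ∪ Q = Set.univ ∧ ∃ s t : Position C,
      ((∀ c, s c ≠ none) ∧ D.ConnectedAt s ∧ smoothedAs m s ⊆ P) ∧
      (∀ c, t c ≠ none) ∧ D.ConnectedAt t ∧ smoothedAs m t ⊆ Q := by
  have h0 : smoothedAs m (start : Position C) = ∅ :=
    Set.eq_empty_of_forall_notMem fun c hc => nomatch (show none = some (m c) from hc)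
  have hY : D.Follows m .disconnecter ∅ Set.univ := ⟨start, h, h0.subset, by simp⟩
  obtain ⟨c⟩ := ‹Nonempty C›
  -- A fictitious rival's claim of `c` gives the first claimer a position with the connecter to
  -- move; `c` itself stays claimable.
  obtain ⟨s, hs, h1, h2⟩ := hY.of_opponent c
  have hX : D.Follows m .connecter ∅ Set.univ := ⟨s, hs, h1, by simp⟩
  simpa only [Set.empty_union] using hX.exists_partition hY

end Strategy

end LinkSmoothing.Shadow

namespace LinkSmoothing.Shadow

/-! ### Single curves and the checkerboard graph -/

section Checkerboard

variable {C : Type*} {D : Shadow C} (K : D.Checkerboard)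

theorem region_boundary (h : HalfEdge C) : D.region (D.boundary h) = D.region h :=
  Quotient.sound (Equiv.Perm.sameCycle_apply_left.2 (.refl _ _))

theorem region_arc_sub_one (h : HalfEdge C) :
    D.region ((D.arc h).1, (D.arc h).2 - 1) = D.region h :=
  region_boundary h

theorem region_sub_one (h : HalfEdge C) : D.region (h.1, h.2 - 1) = D.region (D.arc h) := by
  rw [← region_arc_sub_one (D.arc h), D.arc_involutive h]

namespace Checkerboard

/-- The opposite colouring. -/
def compl : D.Checkerboard where
  shaded := K.shadedᶜ
  alternate c i := by rw [Set.mem_compl_iff, Set.mem_compl_iff, K.alternate c i]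

open Classical in
/-- The smoothing of a precrossing that merges the two shaded regions there. -/
noncomputable def merging (c : C) : Bool := decide (D.region (c, 1) ∈ K.shaded)

theorem merging_compl (c : C) : K.compl.merging c = !K.merging c := by
  unfold merging compl
  by_cases h : D.region (c, 1) ∈ K.shaded <;> simp [h]

open Classical in
/-- The shaded region beside a half-edge. -/
noncomputable def side (h : HalfEdge C) : D.Region :=
  if D.region h ∈ K.shaded then D.region h else D.region (h.1, h.2 - 1)

theorem side_mem (h : HalfEdge C) : K.side h ∈ K.shaded := by
  unfold side
  split_ifs with hh
  · exact hh
  · by_contra h'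
    exact hh ((K.alternate h.1 h.2).2 h')

theorem side_arc (h : HalfEdge C) : K.side (D.arc h) = K.side h := by
  have h1 := region_arc_sub_one (D := D) h
  have h2 := region_sub_one (D := D) h
  have h3 := K.alternate h.1 h.2
  unfold side
  rw [h1, h2]
  rw [h2] at h3
  split_ifs with ha hb hb
  · exact absurd ha (h3.1 hb)
  · rfl
  · rfl
  · exact absurd (h3.2 ha) hb

theorem region_add_one_mem (c : C) (i : ZMod 4) :
    D.region (c, i + 1) ∈ K.shaded ↔ D.region (c, i) ∉ K.shaded := by
  simpa using K.alternate c (i + 1)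

theorem region_add_two_mem (c : C) (i : ZMod 4) :
    D.region (c, i + 2) ∈ K.shaded ↔ D.region (c, i) ∈ K.shaded := by
  rw [show i + 2 = i + 1 + 1 by ring, region_add_one_mem, region_add_one_mem, not_not]

theorem edgeSet_graph : K.graph.edgeSet = Set.univ := by
  have link : ∀ (c : C) (i : ZMod 4), D.region (c, i) ∈ K.shaded → c ∈ K.graph.edgeSet :=
    fun c i h => ⟨_, _, i, rfl, rfl, h, (K.region_add_two_mem c i).2 h⟩
  refine Set.eq_univ_of_forall fun c => ?_
  by_cases h : D.region (c, 0) ∈ K.shaded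
  · exact link c 0 h
  · exact link c (0 + 1) ((K.region_add_one_mem c 0).2 h)

theorem side_add_one_of_mem {c : C} {i : ZMod 4} (h : D.region (c, i) ∈ K.shaded) :
    K.side (c, i + 1) = K.side (c, i) := by
  have h' := mt (K.region_add_one_mem c i).1 (not_not_intro h)
  simp [side, h, h']

theorem isLink_side_add_one {c : C} {i : ZMod 4} (h : D.region (c, i) ∉ K.shaded) :
    K.graph.IsLink c (K.side (c, i)) (K.side (c, i + 1)) := by
  have h' := (K.region_add_one_mem c i).2 h
  refine ⟨i - 1, ?_, ?_, K.side_mem _, K.side_mem _⟩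
  · simp [side, h]
  · simp [side, h', show i - 1 + 2 = i + 1 by ring]

/-- The smoothing `b` joins the half-edges `i` and `i + 1`. It thus cuts off corner `i`, and if that
corner is unshaded, the shaded ones merge. -/
theorem merging_eq {c : C} {b : Bool} {i : ZMod 4} (hi : b = true ↔ i = 0 ∨ i = 2)
    (h : D.region (c, i) ∉ K.shaded) : K.merging c = b := by
  have h0 := K.region_add_one_mem c 0
  have h2 := K.region_add_two_mem c 0
  have h3 := K.region_add_two_mem c 1
  rw [zero_add] at h0 h2
  rw [show (1 + 2 : ZMod 4) = 3 from rfl] at h3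
  have hcases : ∀ i : ZMod 4, i = 0 ∨ i = 1 ∨ i = 2 ∨ i = 3 := by decide
  have hne : (1 : ZMod 4) ≠ 0 ∧ (1 : ZMod 4) ≠ 2 ∧ (3 : ZMod 4) ≠ 0 ∧ (3 : ZMod 4) ≠ 2 := by decide
  refine Bool.eq_iff_iff.2 (Iff.trans ?_ hi.symm)
  simp only [merging, decide_eq_true_eq]
  rcases hcases i with rfl | rfl | rfl | rfl <;> tauto

theorem reflTransGen_side_of_smoothed {s : Position C} {c : C} {b : Bool} (hc : s c = some b)
    {i : ZMod 4} (hi : b = true ↔ i = 0 ∨ i = 2) :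
    Relation.ReflTransGen (K.graph.restrict (smoothedAs K.merging s)).Adj
      (K.side (c, i)) (K.side (c, i + 1)) := by
  by_cases h : D.region (c, i) ∈ K.shaded
  · rw [K.side_add_one_of_mem h]
  · refine .single ⟨c, ?_, K.isLink_side_add_one h⟩
    rw [smoothedAs, Set.mem_ofPred_eq, hc, K.merging_eq hi h]

theorem partner_cases : ∀ (b : Bool) (i : ZMod 4),
    (partner b i = i + 1 ∧ (b = true ↔ i = 0 ∨ i = 2)) ∨
      (i = partner b i + 1 ∧ (b = true ↔ partner b i = 0 ∨ partner b i = 2)) := by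
  decide

/-- If a diagram without precrossings is a single curve, then the precrossings at which shaded
regions have been merged connect the associated graph. -/
theorem isConnected_restrict {s : Position C} (hs : ∀ c, s c ≠ none) (hconn : D.ConnectedAt s) :
    LinkSmoothing.IsConnected (K.graph.restrict (smoothedAs K.merging s)) := by
  have key : ∀ h h', Relation.EqvGen (D.Touch s) h h' →
      Relation.ReflTransGen (K.graph.restrict (smoothedAs K.merging s)).Adj
        (K.side h) (K.side h') := by
    intro h h' hh
    induction hh with
    | rel h h' hh =>
      cases hh with
      | arc => rw [side_arc]
      | precrossing c i j hc => exact absurd hc (hs c)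
      | smoothed c b i hc =>
        rcases partner_cases b i with ⟨h1, h2⟩ | ⟨h1, h2⟩
        · rw [h1]
          exact K.reflTransGen_side_of_smoothed hc h2
        · have := reflTransGen_adj_symm (K.reflTransGen_side_of_smoothed hc h2)
          rwa [← h1] at this
    | refl => exact .refl
    | symm _ _ _ ih => exact reflTransGen_adj_symm ih
    | trans _ _ _ _ _ ih ih' => exact ih.trans ih'
  have hside : ∀ x ∈ K.shaded, ∃ h, K.side h = x := by
    intro x hx
    induction x using Quotient.inductionOn with
    | h h => exact ⟨h, if_pos hx⟩
  obtain ⟨⟨h⟩, hall⟩ := hconn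
  refine ⟨⟨K.side h, K.side_mem h⟩, fun x hx y hy => ?_⟩
  obtain ⟨h, rfl⟩ := hside x hx
  obtain ⟨h', rfl⟩ := hside y hy
  exact key h h' (hall h h')

/-- The edge bounds for `K` and `K.compl` concern complementary sets of precrossings. They add up to
|C| + 2 regions, which is an equality by Euler's formula, so each bound is sharp. -/
theorem ncard_smoothedAs_merging_add_one [Finite C] (hsph : D.IsSpherical) {s : Position C}
    (hs : ∀ c, s c ≠ none) (hconn : D.ConnectedAt s) :
    (smoothedAs K.merging s).ncard + 1 = K.shaded.ncard := by
  have : Finite D.Region := Quotient.finite _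
  have bound : ∀ K' : D.Checkerboard,
      K'.shaded.ncard ≤ (smoothedAs K'.merging s).ncard + 1 := by
    intro K'
    have h := (K'.isConnected_restrict hs hconn).ncard_vertexSet_le (Set.toFinite _)
    exact h.trans (Nat.succ_le_succ (Set.ncard_le_ncard Set.inter_subset_right))
  have hcompl : smoothedAs K.compl.merging s = (smoothedAs K.merging s)ᶜ := by
    ext c
    obtain ⟨b, hb⟩ := Option.ne_none_iff_exists.1 (hs c)
    rw [Set.mem_compl_iff, smoothedAs, smoothedAs, Set.mem_ofPred_eq, Set.mem_ofPred_eq, ← hb,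
      merging_compl, Option.some_inj, Option.some_inj]
    cases b <;> cases K.merging c <;> decide
  have h1 := bound K
  have h2 := bound K.compl
  have h3 := Set.ncard_add_ncard_compl (smoothedAs K.merging s)
  have h4 := Set.ncard_add_ncard_compl K.shaded
  rw [hcompl] at h2
  change K.shadedᶜ.ncard ≤ _ at h2
  have h5 : Nat.card D.Region = Nat.card C + 2 := hsph
  omega

end Checkerboard

end Checkerboard

end LinkSmoothing.Shadow

theorem mainTheorem3 {C : Type*} [Finite C] [DecidableEq C] (D : LinkSmoothing.Shadow C)
    (hconn : D.IsConnected) (hsph : D.IsSpherical) (K : D.Checkerboard) (hP : D.IsPPosition) :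
    ∃ T₁ T₂ : Graph D.Region C,
      LinkSmoothing.IsSpanningTree T₁ K.graph ∧ LinkSmoothing.IsSpanningTree T₂ K.graph ∧
        Disjoint T₁.edgeSet T₂.edgeSet ∧ T₁.edgeSet ∪ T₂.edgeSet = K.graph.edgeSet := by
  have : Finite D.Region := Quotient.finite _
  have : Nonempty C := hconn.1.map Prod.fst
  have hwin : D.HasWinningStrategy .connecter .disconnecter LinkSmoothing.Shadow.start :=
    hP .connecter
  obtain ⟨F, F', hdisj, hunion, s, t, ⟨hs, hsc, hsF⟩, ht, htc, htF⟩ :=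
    hwin.exists_partition K.merging
  refine LinkSmoothing.exists_isSpanningTree_of_partition (Set.toFinite _) ?_ hdisj
    (hunion.trans K.edgeSet_graph.symm) ((K.isConnected_restrict hs hsc).restrict_mono hsF)
    ((K.isConnected_restrict ht htc).restrict_mono htF)
  -- A play in which the disconnecter always merges yields |C| ≤ 2(|V| - 1).
  obtain ⟨u, hu, huc, hcard, -⟩ := hwin.exists_final_ncard K.merging
  have h1 := hcard rfl
  have h2 := K.ncard_smoothedAs_merging_add_one hsph hu huc
  have h3 : LinkSmoothing.Shadow.remaining (LinkSmoothing.Shadow.start : _ → Option Bool) =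
      (Set.univ : Set C) := Set.eq_univ_of_forall fun _ => rfl
  rw [h3] at h1
  rw [K.edgeSet_graph]
  change _ ≤ 2 * K.shaded.ncard
  omega
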